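/- **Corollary 3.6 (Lyapunov function restatement).** Let $f:X\to X$ and $g:Y\to Y$ be continuous maps of compact metric spaces, with metrics $d_X$ and $d_Y$, respectively. Let $f\times g:X\times Y\to X\times Y$ be the product map $(x,y)\mapsto(f(x),g(y))$, give $X\times Y$ the product topology, and let $D_{d_X,d_Y}$ be the metric on $X\times Y$ given by $D_{d_X,d_Y}((x_1,y_1),(x_2,y_2))=d_X(x_1,x_2)+d_Y(y_1,y_2)$. For a map $h:Z\to Z$, a Lyapunov function for $h$ is a function $\theta:Z\to\mathbb R$ with $\theta(h(z))\le\theta(z)$ for all $z\in Z$, and its set of neutral points is $N(\theta)=\{z\in Z:\theta(h(z))=\theta(z)\}$. Let $L(h)$ be the set of continuous Lyapunov functions for $h$ and, for a metric $d$ on $Z$, let $L_d(h)$ be the set of Lyapunov functions for $h$ that are Lipschitz with respect to $d$. Then, for all $x\in X$ and $y\in Y$: 1. $(x,y)\in\bigcap_{\Theta\in L(f\times g)}N(\Theta)$ if and only if $x\in\bigcap_{\theta\in L(f)}N(\theta)$ and $y\in\bigcap_{\phi\in L(g)}N(\phi)$. 2. $(x,y)\in\bigcap_{\Theta\in L_{D_{d_X,d_Y}}(f\times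 g)}N(\Theta)$ if and only if $x\in\bigcap_{\theta\in L_{d_X}(f)}N(\theta)$ and $y\in\bigcap_{\phi\in L_{d_Y}(g)}N(\phi)$. -/

import Mathlib

namespace ProductRecurrence

/-- `θ` is a Lyapunov function for `h` (no regularity required). -/
def IsLyapunov {Z : Type*} (h : Z → Z) (θ : Z → ℝ) : Prop :=
  ∀ z, θ (h z) ≤ θ z

/-- The set `N(θ)` of neutral points of `θ`, with respect to the map `h`. -/
def neutralSet {Z : Type*} (h : Z → Z) (θ : Z → ℝ) : Set Z :=
  {z | θ (h z) = θ z}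

/-- The set `L(h)` of continuous Lyapunov functions for `h`. -/
def continuousLyapunov {Z : Type*} [TopologicalSpace Z] (h : Z → Z) : Set (Z → ℝ) :=
  {θ | Continuous θ ∧ IsLyapunov h θ}

/-- The set `L_d(h)` of Lyapunov functions for `h` that are Lipschitz with respect to the
metric `d`, which is an explicit argument. -/
def lipschitzLyapunov {Z : Type*} (d : MetricSpace Z) (h : Z → Z) : Set (Z → ℝ) :=
  {θ | (∃ K : NNReal, LipschitzWith K θ) ∧ IsLyapunov h θ}

/-- The sum metric `D((x₁, y₁), (x₂, y₂)) = dX(x₁, x₂) + dY(y₁, y₂)` on `X × Y`. It is not an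
instance, since Mathlib's own metric on `X × Y` is the maximum metric. -/
abbrev sumMetric {X Y : Type*} (dX : MetricSpace X) (dY : MetricSpace Y) :
    MetricSpace (X × Y) where
  dist p q := dX.dist p.1 q.1 + dY.dist p.2 q.2
  dist_self p := by simp
  dist_comm p q := by simp only [dist_comm]
  dist_triangle p q r := by
    have h1 := dist_triangle p.1 q.1 r.1
    have h2 := dist_triangle p.2 q.2 r.2
    linarith
  eq_of_dist_eq_zero {p q} h := by
    have h1 : 0 ≤ dist p.1 q.1 := dist_nonneg
    have h2 : 0 ≤ dist p.2 q.2 := dist_nonneg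
    have h3 : dist p.1 q.1 + dist p.2 q.2 = 0 := h
    exact Prod.ext (dist_eq_zero.mp (by linarith)) (dist_eq_zero.mp (by linarith))

end ProductRecurrence

namespace ProductRecurrence

open Set Function Topology

/-! Lyapunov functions of a factor pull back along the projections. Conversely, neutrality on the
factors gives loops of small total error at `x` and at `y` (`strongChain_self_of_neutral`); two such
loops of equal length form a loop in the product, forcing `Θ (x, y) ≤ Θ (f x, g y)` up to an error.
Equalizing lengths by plain repetition would multiply the errors without bound. Instead, loops are
routed near a uniformly recurrent point of the product, where a bounded number of repetitions
suffices and return times correct the lengths (`StrongChain.exists_common_length`). The continuous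
case reduces to the Lipschitz one by a change of metrics. -/

/-- `PseudoOrbit f n a b c` says that there is a pseudo-orbit of `f` with `n` steps from `a` to `b`
the sum of whose errors `dist (f xᵢ) xᵢ₊₁` is at most `c`. -/
inductive PseudoOrbit {X : Type*} [PseudoMetricSpace X] (f : X → X) : ℕ → X → X → ℝ → Prop
  | nil {a : X} {c : ℝ} (hc : 0 ≤ c) : PseudoOrbit f 0 a a c
  | step {n : ℕ} {a b b' : X} {c c' : ℝ} (h : PseudoOrbit f n a b c)
      (hc : c + dist (f b) b' ≤ c') : PseudoOrbit f (n + 1) a b' c'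

namespace PseudoOrbit

variable {X : Type*} [PseudoMetricSpace X] {f : X → X} {n m : ℕ} {a a' b b' e : X} {c c' : ℝ}

theorem cost_nonneg (h : PseudoOrbit f n a b c) : 0 ≤ c := by
  induction h with
  | nil hc => exact hc
  | step _ hc ih => exact (add_nonneg ih dist_nonneg).trans hc

theorem mono (h : PseudoOrbit f n a b c) (hc : c ≤ c') : PseudoOrbit f n a b c' := by
  cases h with
  | nil h0 => exact nil (h0.trans hc)
  | step h h' => exact step h (h'.trans hc)

theorem trans (h : PseudoOrbit f n a b c) (h' : PseudoOrbit f m b e c') :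
    PseudoOrbit f (n + m) a e (c + c') := by
  induction h' with
  | nil h0 => exact h.mono (by linarith)
  | step _ hc ih => exact step (ih h) (by linarith)

theorem orbit (f : X → X) (a : X) (k : ℕ) : PseudoOrbit f k a (f^[k] a) 0 := by
  induction k with
  | zero => exact nil le_rfl
  | succ k ih =>
    rw [iterate_succ_apply']
    exact step ih (by simp)

theorem move_end (h : PseudoOrbit f (n + 1) a b c) (b' : X) :
    PseudoOrbit f (n + 1) a b' (c + dist b b') := by
  cases h with
  | @step _ _ e _ _ _ h hc =>
    exact step h (by linarith [dist_triangle (f e) b b'])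

theorem move_start (h : PseudoOrbit f (n + 1) a b c) (a' : X) :
    PseudoOrbit f (n + 1) a' b (c + dist (f a') (f a)) := by
  induction n generalizing b c with
  | zero =>
    cases h with
    | step h hc =>
      cases h with
      | nil h0 => exact step (nil le_rfl) (by linarith [dist_triangle (f a') (f a) b])
  | succ n ih =>
    cases h with
    | step h hc => exact step (ih h) (by linarith)

theorem exists_tail (h : PseudoOrbit f (n + 1) a b c) :
    ∃ a' c', PseudoOrbit f n a' b c' ∧ dist (f a) a' + c' ≤ c := by
  induction n generalizing b c with
  | zero =>
    cases h with
    | step h hc =>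
      cases h with
      | nil h0 => exact ⟨b, 0, nil le_rfl, by linarith⟩
  | succ n ih =>
    cases h with
    | step h hc =>
      obtain ⟨a', c', h', hc'⟩ := ih h
      exact ⟨a', _, step h' le_rfl, by linarith⟩

theorem of_dist_iterate_le {k : ℕ} (h : dist (f^[k] a) a ≤ c) : PseudoOrbit f k a a c := by
  cases k with
  | zero => exact nil (dist_nonneg.trans h)
  | succ k => exact ((orbit f a (k + 1)).move_end a).mono (by simpa using h)

theorem loop_iterate (h : PseudoOrbit f n a a c) (j : ℕ) : PseudoOrbit f (j * n) a a (j * c) := by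
  induction j with
  | zero => simpa using nil le_rfl
  | succ j ih =>
    have := ih.trans h
    rw [Nat.succ_mul]
    exact this.mono (by push_cast; linarith)

end PseudoOrbit

open PseudoOrbit

/-- `b` can be reached from `a` by nontrivial pseudo-orbits of arbitrarily small total error. -/
def StrongChain {X : Type*} [PseudoMetricSpace X] (f : X → X) (a b : X) : Prop :=
  ∀ ε > 0, ∃ n, PseudoOrbit f (n + 1) a b ε

section StrongChain

variable {X : Type*} [PseudoMetricSpace X] {f : X → X} {x u : X}

/-- A point that is neutral for all `1`-Lipschitz Lyapunov functions is strongly chain recurrent. -/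
theorem strongChain_self_of_neutral
    (h : ∀ θ : X → ℝ, LipschitzWith 1 θ → IsLyapunov f θ → θ (f x) = θ x) :
    StrongChain f x x := by
  -- The cheapest cost from `x` is the test function: moving the endpoint makes it 1-Lipschitz, and
  -- free exact steps make it decrease along `f`.
  let S : X → Set ℝ := fun z => {c | ∃ n, PseudoOrbit f (n + 1) x z c}
  have hne : ∀ z, (S z).Nonempty := fun z =>
    ⟨_, 0, ((orbit f x 1).move_end z)⟩
  have hbdd : ∀ z, BddBelow (S z) := fun z => ⟨0, fun c ⟨_, hc⟩ => hc.cost_nonneg⟩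
  have hlip : LipschitzWith 1 fun z => sInf (S z) := by
    refine LipschitzWith.of_le_add fun z w => ?_
    rw [← sub_le_iff_le_add]
    refine le_csInf (hne w) fun c ⟨n, hc⟩ => ?_
    have := csInf_le (hbdd z) ⟨n, hc.move_end z⟩
    rw [dist_comm w z] at this
    linarith
  have hlyap : IsLyapunov f fun z => sInf (S z) := fun z =>
    le_csInf (hne z) fun c ⟨n, hc⟩ => csInf_le (hbdd _) ⟨n + 1, step hc (by simp)⟩
  have hx : sInf (S x) ≤ 0 := by
    rw [← h _ hlip hlyap]
    exact csInf_le (hbdd _) ⟨0, orbit f x 1⟩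
  intro ε hε
  obtain ⟨c, ⟨n, hc⟩, hcε⟩ := exists_lt_of_csInf_lt (hne x) (hx.trans_lt hε)
  exact ⟨n, hc.mono hcε.le⟩

theorem StrongChain.apply_left (hf : Continuous f) (hx : StrongChain f x x)
    (hu : StrongChain f u x) : StrongChain f (f u) x := by
  intro ε hε
  obtain ⟨η, hη, hfη⟩ := Metric.continuous_iff.1 hf (f u) (ε / 2) (half_pos hε)
  have hpos : 0 < min η ε / 4 := by positivity
  obtain ⟨n, hn⟩ := hu _ hpos
  obtain ⟨m, hm⟩ := hx _ hpos
  -- The extra loop guarantees a second step, so the pseudo-orbit stays nontrivial once its first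
  -- step is dropped.
  have h := hn.trans hm
  rw [show n + 1 + (m + 1) = n + m + 1 + 1 by ring] at h
  obtain ⟨a, c, ha, hc⟩ := h.exists_tail
  have hηε : min η ε ≤ η := min_le_left _ _
  have hηε' : min η ε ≤ ε := min_le_right _ _
  have hc0 := ha.cost_nonneg
  have hd : dist (f u) a ≥ 0 := dist_nonneg
  have := hfη a (by rw [dist_comm]; linarith)
  rw [dist_comm] at this
  exact ⟨n + m, (ha.move_start (f u)).mono (by linarith)⟩

theorem StrongChain.iterate_left (hf : Continuous f) (hx : StrongChain f x x) (k : ℕ) :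
    StrongChain f (f^[k] x) x := by
  induction k with
  | zero => exact hx
  | succ k ih =>
    rw [iterate_succ_apply']
    exact hx.apply_left hf ih

/-- A strongly chain recurrent point can be reached from its orbit closure. -/
theorem StrongChain.of_mem_closure (hf : Continuous f) (hx : StrongChain f x x)
    (hu : ∀ δ > 0, ∃ k, dist (f^[k] x) u < δ) : StrongChain f u x := by
  intro ε hε
  obtain ⟨η, hη, hfη⟩ := Metric.continuous_iff.1 hf u (ε / 2) (half_pos hε)
  obtain ⟨k, hk⟩ := hu η hη
  obtain ⟨n, hn⟩ := hx.iterate_left hf k (ε / 2) (half_pos hε)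
  have := hfη _ hk
  rw [dist_comm] at this
  exact ⟨n, (hn.move_start u).mono (by linarith)⟩

/-- Loops at `x` passing through a point `u` of the orbit closure, into which a loop at `u` has been
inserted. -/
theorem StrongChain.exists_loop (hf : Continuous f) (hx : StrongChain f x x)
    (hu : ∀ δ > 0, ∃ k, dist (f^[k] x) u < δ) {ε : ℝ} (hε : 0 < ε) :
    ∃ n, ∀ j r δ, PseudoOrbit f r u u δ →
      PseudoOrbit f ((j + 1) * (n + 1) + r) x x ((j + 1) * ε + δ) := by
  obtain ⟨m, hm⟩ := hx.of_mem_closure hf hu (ε / 3) (by positivity)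
  obtain ⟨l, hl⟩ := hx (ε / 3) (by positivity)
  obtain ⟨k, hk⟩ := hu (ε / 3) (by positivity)
  have hxu : PseudoOrbit f (l + 1 + k) x u (2 * ε / 3) := by
    have h := hl.trans (orbit f x k)
    rw [show l + 1 + k = l + k + 1 by ring] at h ⊢
    exact (h.move_end u).mono (by linarith)
  refine ⟨l + 1 + k + m, fun j r δ hr => ?_⟩
  have h := ((hxu.trans hm).loop_iterate j).trans ((hxu.trans hr).trans hm)
  convert h using 1 <;> ring

end StrongChain

/-! ### Uniform recurrence and return times -/

section UniformRecurrence

variable {Z : Type*} [PseudoMetricSpace Z] {T : Z → Z}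

/-- The orbit closure of any point contains a uniformly recurrent point. -/
theorem exists_uniformlyRecurrent [CompactSpace Z] (hT : Continuous T) (z : Z) :
    ∃ p, (∀ δ > 0, ∃ k, dist (T^[k] z) p < δ) ∧
      ∀ δ > 0, ∃ B, ∀ j, ∃ c ≤ B, dist (T^[c] (T^[j] p)) p < δ := by
  let S : Set (Set Z) := {C | IsClosed C ∧ C.Nonempty ∧ MapsTo T C C}
  have horb : ∀ q, closure (range fun k => T^[k] q) ∈ S := fun q =>
    ⟨isClosed_closure, (range_nonempty _).closure, by
      refine MapsTo.closure ?_ hT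
      rintro _ ⟨k, rfl⟩
      exact ⟨k + 1, iterate_succ_apply' ..⟩⟩
  -- In a minimal closed invariant set every orbit is dense; compactness then bounds the return
  -- times.
  obtain ⟨M, hMz, hM⟩ := zorn_superset_nonempty S (fun c hc hchain hne => by
    have : Nonempty c := hne.to_subtype
    refine ⟨⋂₀ c, ⟨isClosed_sInter fun s hs => (hc hs).1, ?_, ?_⟩,
      fun s hs => sInter_subset_of_mem hs⟩
    · exact IsCompact.nonempty_sInter_of_directed_nonempty_isCompact_isClosed
        (fun s hs t ht => (hchain.total hs ht).elim (fun h => ⟨s, hs, Subset.rfl, h⟩)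
          fun h => ⟨t, ht, h, Subset.rfl⟩) (fun s hs => (hc hs).2.1)
        (fun s hs => (hc hs).1.isCompact) (fun s hs => (hc hs).1)
    · exact fun w hw s hs => (hc hs).2.2 (hw s hs)) _ (horb z)
  obtain ⟨hMcl, ⟨p, hp⟩, hMT⟩ := hM.prop
  have key : ∀ q, p ∈ closure (range fun k => T^[k] q) → ∀ δ > 0, ∃ k, dist (T^[k] q) p < δ := by
    intro q hq δ hδ
    obtain ⟨_, ⟨k, rfl⟩, hk⟩ := Metric.mem_closure_iff.1 hq δ hδ
    exact ⟨k, by rwa [dist_comm]⟩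
  refine ⟨p, key z (hMz hp), fun δ hδ => ?_⟩
  have hcover : M ⊆ ⋃ k, (T^[k]) ⁻¹' Metric.ball p δ := by
    intro q hq
    have hsub : closure (range fun k => T^[k] q) ⊆ M := by
      refine closure_minimal ?_ hMcl
      rintro _ ⟨k, rfl⟩
      exact hMT.iterate k hq
    obtain ⟨k, hk⟩ := key q (hM.le_of_le (horb q) hsub hp) δ hδ
    exact mem_iUnion.2 ⟨k, hk⟩
  obtain ⟨t, ht⟩ := hMcl.isCompact.elim_finite_subcover _
    (fun k => Metric.isOpen_ball.preimage (hT.iterate k)) hcover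
  refine ⟨t.sup id, fun j => ?_⟩
  obtain ⟨c, hc, hcj⟩ := mem_iUnion₂.1 (ht (hMT.iterate j hp))
  exact ⟨c, Finset.le_sup (f := id) hc, hcj⟩

/-- For a uniformly recurrent point, every `n` has a multiple by a bounded positive factor which is
the difference of two `δ`-return times. -/
theorem exists_bounded_multiple {p : Z} {δ : ℝ}
    (h : ∃ B, ∀ j, ∃ c ≤ B, dist (T^[c] (T^[j] p)) p < δ) :
    ∃ G : ℕ, ∀ n : ℕ, ∃ j ≤ G, ∃ a b : ℕ, (j + 1) * n + a = b ∧
      dist (T^[a] p) p < δ ∧ dist (T^[b] p) p < δ := by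
  obtain ⟨B, hB⟩ := h
  refine ⟨B, fun n => ?_⟩
  -- Pigeonhole: two of the `B + 2` delays `c j` agree, so the corresponding return times `j * n + c
  -- j` differ by a multiple of `n`.
  choose c hcB hc using fun j => hB (j * n)
  obtain ⟨i, hi, j, hj, hij, hcij⟩ := Finset.exists_ne_map_eq_of_card_lt_of_maps_to
    (s := Finset.range (B + 2)) (t := Finset.range (B + 1)) (f := c) (by simp)
    (fun j _ => by simpa using Nat.lt_succ_of_le (hcB j))
  wlog hlt : i < j generalizing i j
  · exact this j hj i hi hij.symm hcij.symm (by omega)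
  have hi' := hc i
  have hj' := hc j
  rw [← iterate_add_apply] at hi' hj'
  rw [← hcij] at hj'
  obtain ⟨d, rfl⟩ := Nat.exists_eq_add_of_lt hlt
  rw [Finset.mem_range] at hj
  exact ⟨d, by omega, _, _, by ring, hi', hj'⟩

end UniformRecurrence

/-! ### Synchronized loops in the product -/

section Product

variable {X Y : Type*} [PseudoMetricSpace X] [PseudoMetricSpace Y] {f : X → X} {g : Y → Y}

/-- Strongly chain recurrent points `x` and `y` admit loops of the same length and of small total
error. -/
theorem StrongChain.exists_common_length [CompactSpace X] [CompactSpace Y] (hf : Continuous f)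
    (hg : Continuous g) {x : X} {y : Y} (hx : StrongChain f x x) (hy : StrongChain g y y)
    {ε : ℝ} (hε : 0 < ε) :
    ∃ N, PseudoOrbit f (N + 1) x x ε ∧ PseudoOrbit g (N + 1) y y ε := by
  obtain ⟨⟨u, v⟩, hcl, hrec⟩ := exists_uniformlyRecurrent (hf.prodMap hg) (x, y)
  have hprod : ∀ k z w, (∀ δ, dist ((Prod.map f g)^[k] z) w < δ ↔
      dist (f^[k] z.1) w.1 < δ ∧ dist (g^[k] z.2) w.2 < δ) := by
    intro k z w δ
    rw [Prod.map_iterate, Prod.dist_eq, max_lt_iff]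
    rfl
  have hxu : ∀ δ > 0, ∃ k, dist (f^[k] x) u < δ := fun δ hδ =>
    (hcl δ hδ).imp fun k hk => ((hprod k _ _ δ).1 hk).1
  have hyv : ∀ δ > 0, ∃ k, dist (g^[k] y) v < δ := fun δ hδ =>
    (hcl δ hδ).imp fun k hk => ((hprod k _ _ δ).1 hk).2
  obtain ⟨G, hG⟩ := exists_bounded_multiple (hrec (ε / 3) (by positivity))
  -- `G` is fixed before the loops are chosen, so their error can absorb up to `G + 1` repetitions.
  have hη : 0 < ε / 3 / (G + 1) := by positivity
  obtain ⟨n, hn⟩ := hx.exists_loop hf hxu hη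
  obtain ⟨m, hm⟩ := hy.exists_loop hg hyv hη
  obtain ⟨j, hj, a, b, hab, ha, hb⟩ := hG (n + 1)
  obtain ⟨i, hi, a', b', hab', ha', hb'⟩ := hG (m + 1)
  rw [hprod] at ha hb ha' hb'
  have hcost : ∀ k : ℕ, k ≤ G → ((k : ℝ) + 1) * (ε / 3 / (G + 1)) + (ε / 3 + ε / 3) ≤ ε := by
    intro k hk
    have hk' : (k : ℝ) + 1 ≤ G + 1 := by exact_mod_cast Nat.succ_le_succ hk
    have := mul_le_mul_of_nonneg_right hk' hη.le
    rw [mul_div_cancel₀ _ (by positivity : (G : ℝ) + 1 ≠ 0)] at this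
    linarith
  -- Inserting returns `a`, `b'` on one side and `a'`, `b` on the other makes both lengths `b + b'`.
  have h1 := (hn j _ _ ((of_dist_iterate_le ha.1.le).trans
    (of_dist_iterate_le hb'.1.le))).mono (hcost j hj)
  have h2 := (hm i _ _ ((of_dist_iterate_le ha'.2.le).trans
    (of_dist_iterate_le hb.2.le))).mono (hcost i hi)
  have hpos : 1 ≤ b := by nlinarith
  refine ⟨b + b' - 1, ?_, ?_⟩
  · convert h1 using 1
    omega
  · convert h2 using 1
    omega

/-- Equal lengths let the pseudo-orbits run in parallel. Bounding by the value at the image of the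
start is what yields neutrality on loops. -/
theorem lyapunov_le_of_pseudoOrbit {Θ : X × Y → ℝ} {K : ℝ} (hK : 0 ≤ K)
    (hΘ : ∀ p q : X × Y, Θ p ≤ Θ q + K * (dist p.1 q.1 + dist p.2 q.2))
    (hL : IsLyapunov (Prod.map f g) Θ) {n : ℕ} {a b : X} {a' b' : Y} {c c' : ℝ}
    (h : PseudoOrbit f (n + 1) a b c) (h' : PseudoOrbit g (n + 1) a' b' c') :
    Θ (b, b') ≤ Θ (f a, g a') + K * (c + c') := by
  induction n generalizing b b' c c' with
  | zero =>
    cases h with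
    | step h hc =>
      cases h' with
      | step h' hc' =>
        cases h with
        | nil h0 =>
          cases h' with
          | nil h0' =>
            refine (hΘ (b, b') (f a, g a')).trans ?_
            gcongr
            · rw [dist_comm]; linarith
            · rw [dist_comm]; linarith
  | succ n ih =>
    cases h with
    | @step _ _ e _ d _ h hc =>
      cases h' with
      | @step _ _ e' _ d' _ h' hc' =>
        have h1 := hΘ (b, b') (f e, g e')
        have h2 : Θ (f e, g e') ≤ Θ (e, e') := hL (e, e')
        have h3 := ih h h'
        rw [dist_comm b, dist_comm b'] at h1
        have h4 := mul_le_mul_of_nonneg_left (add_le_add hc hc') hK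
        simp only at h1
        linarith

/-- Lipschitz Lyapunov functions on the product are neutral at pairs of points which are neutral for
all `1`-Lipschitz Lyapunov functions on the factors. -/
theorem neutral_prod_of_neutral [CompactSpace X] [CompactSpace Y] (hf : Continuous f)
    (hg : Continuous g) {x : X} {y : Y}
    (hx : ∀ θ : X → ℝ, LipschitzWith 1 θ → IsLyapunov f θ → θ (f x) = θ x)
    (hy : ∀ φ : Y → ℝ, LipschitzWith 1 φ → IsLyapunov g φ → φ (g y) = φ y)
    {Θ : X × Y → ℝ} {K : ℝ} (hK : 0 ≤ K)
    (hΘ : ∀ p q : X × Y, Θ p ≤ Θ q + K * (dist p.1 q.1 + dist p.2 q.2))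
    (hL : IsLyapunov (Prod.map f g) Θ) : Θ (f x, g y) = Θ (x, y) := by
  refine le_antisymm (hL (x, y)) (le_of_forall_pos_le_add fun ε hε => ?_)
  have hη : 0 < ε / (2 * (K + 1)) := by positivity
  obtain ⟨N, h1, h2⟩ := (strongChain_self_of_neutral hx).exists_common_length hf hg
    (strongChain_self_of_neutral hy) hη
  refine (lyapunov_le_of_pseudoOrbit hK hΘ hL h1 h2).trans ?_
  have : (K + 1) * (ε / (2 * (K + 1)) + ε / (2 * (K + 1))) = ε := by field_simp; ring
  linarith

end Product

/-! ### Reduction of the continuous case -/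

/-- The graph of a continuous map induces the topology of its domain. -/
theorem isInducing_prodMk_id {A B : Type*} [TopologicalSpace A] [TopologicalSpace B] {F : A → B}
    (hF : Continuous F) : IsInducing fun a => (a, F a) :=
  .of_comp (continuous_id.prodMk hF) continuous_fst .id

theorem neutral_prod_of_neutral_continuous {X Y : Type*} [PseudoMetricSpace X] [CompactSpace X]
    [PseudoMetricSpace Y] [CompactSpace Y] {f : X → X} {g : Y → Y} (hf : Continuous f)
    (hg : Continuous g) {x : X} {y : Y}
    (hx : ∀ θ : X → ℝ, Continuous θ → IsLyapunov f θ → θ (f x) = θ x)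
    (hy : ∀ φ : Y → ℝ, Continuous φ → IsLyapunov g φ → φ (g y) = φ y)
    {Θ : X × Y → ℝ} (hΘ : Continuous Θ) (hL : IsLyapunov (Prod.map f g) Θ) :
    Θ (f x, g y) = Θ (x, y) := by
  let F : C(X, C(Y, ℝ)) := ContinuousMap.curry ⟨Θ, hΘ⟩
  let H : C(Y, C(X, ℝ)) := ContinuousMap.curry ⟨Θ ∘ Prod.swap, hΘ.comp continuous_swap⟩
  -- Adding to each metric, through a maximum, the sup-distance between slices of `Θ` keeps the
  -- topology and makes `Θ` 1-Lipschitz for the sum metric.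
  let mX : PseudoMetricSpace X := (isInducing_prodMk_id F.continuous).comapPseudoMetricSpace
  let mY : PseudoMetricSpace Y := (isInducing_prodMk_id H.continuous).comapPseudoMetricSpace
  refine @neutral_prod_of_neutral X Y mX mY f g ‹_› ‹_› hf hg x y
    (fun θ hθ => hx θ hθ.continuous) (fun φ hφ => hy φ hφ.continuous) Θ 1 zero_le_one ?_ hL
  rintro ⟨p₁, p₂⟩ ⟨q₁, q₂⟩
  have h1 : dist (F p₁) (F q₁) ≤ mX.dist p₁ q₁ := le_max_right _ _
  have h2 : dist (H p₂) (H q₂) ≤ mY.dist p₂ q₂ := le_max_right _ _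
  have h3 : |Θ (p₁, p₂) - Θ (q₁, p₂)| ≤ dist (F p₁) (F q₁) :=
    ContinuousMap.dist_apply_le_dist (f := F p₁) (g := F q₁) p₂
  have h4 : |Θ (q₁, p₂) - Θ (q₁, q₂)| ≤ dist (H p₂) (H q₂) :=
    ContinuousMap.dist_apply_le_dist (f := H p₂) (g := H q₂) q₁
  have h5 := le_of_abs_le h3
  have h6 := le_of_abs_le h4
  change _ ≤ _ + 1 * (mX.dist p₁ q₁ + mY.dist p₂ q₂)
  linarith

end ProductRecurrence

theorem corollary3p6 {X Y : Type*} [dX : MetricSpace X] [CompactSpace X]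
    [dY : MetricSpace Y] [CompactSpace Y]
    (f : X → X) (g : Y → Y) (hf : Continuous f) (hg : Continuous g) (x : X) (y : Y) :
    ((x, y) ∈ (⋂ Θ ∈ ProductRecurrence.continuousLyapunov (Prod.map f g),
        ProductRecurrence.neutralSet (Prod.map f g) Θ) ↔
      (x ∈ (⋂ θ ∈ ProductRecurrence.continuousLyapunov f,
          ProductRecurrence.neutralSet f θ) ∧
        y ∈ (⋂ φ ∈ ProductRecurrence.continuousLyapunov g,
          ProductRecurrence.neutralSet g φ))) ∧
    ((x, y) ∈ (⋂ Θ ∈ ProductRecurrence.lipschitzLyapunov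
          (ProductRecurrence.sumMetric dX dY) (Prod.map f g),
        ProductRecurrence.neutralSet (Prod.map f g) Θ) ↔
      (x ∈ (⋂ θ ∈ ProductRecurrence.lipschitzLyapunov dX f,
          ProductRecurrence.neutralSet f θ) ∧
        y ∈ (⋂ φ ∈ ProductRecurrence.lipschitzLyapunov dY g,
          ProductRecurrence.neutralSet g φ))) := by
  simp only [Set.mem_iInter, ProductRecurrence.continuousLyapunov,
    ProductRecurrence.lipschitzLyapunov, ProductRecurrence.neutralSet, Set.mem_ofPred_eq]
  refine ⟨⟨fun h => ⟨fun θ hθ => ?_, fun φ hφ => ?_⟩, fun h Θ hΘ => ?_⟩,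
    ⟨fun h => ⟨fun θ hθ => ?_, fun φ hφ => ?_⟩, fun h Θ hΘ => ?_⟩⟩
  · exact h (fun p => θ p.1) ⟨hθ.1.comp continuous_fst, fun p => hθ.2 p.1⟩
  · exact h (fun p => φ p.2) ⟨hφ.1.comp continuous_snd, fun p => hφ.2 p.2⟩
  · exact ProductRecurrence.neutral_prod_of_neutral_continuous hf hg
      (fun θ h1 h2 => h.1 θ ⟨h1, h2⟩) (fun φ h1 h2 => h.2 φ ⟨h1, h2⟩) hΘ.1 hΘ.2
  · obtain ⟨⟨K, hK⟩, hθ⟩ := hθ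
    refine h (fun p => θ p.1) ⟨⟨K, ?_⟩, fun p => hθ p.1⟩
    refine @LipschitzWith.of_dist_le_mul _ _
      (ProductRecurrence.sumMetric dX dY).toPseudoMetricSpace _ K _
      fun p q => (hK.dist_le_mul p.1 q.1).trans ?_
    exact mul_le_mul_of_nonneg_left (le_add_of_nonneg_right dist_nonneg) K.2
  · obtain ⟨⟨K, hK⟩, hφ⟩ := hφ
    refine h (fun p => φ p.2) ⟨⟨K, ?_⟩, fun p => hφ p.2⟩
    refine @LipschitzWith.of_dist_le_mul _ _
      (ProductRecurrence.sumMetric dX dY).toPseudoMetricSpace _ K _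
      fun p q => (hK.dist_le_mul p.2 q.2).trans ?_
    exact mul_le_mul_of_nonneg_left (le_add_of_nonneg_left dist_nonneg) K.2
  · obtain ⟨⟨K, hK⟩, hL⟩ := hΘ
    refine ProductRecurrence.neutral_prod_of_neutral hf hg
      (fun θ h1 h2 => h.1 θ ⟨⟨1, h1⟩, h2⟩) (fun φ h1 h2 => h.2 φ ⟨⟨1, h1⟩, h2⟩) K.2
      (fun p q => ?_) hL
    have := (le_abs_self _).trans
      (@LipschitzWith.dist_le_mul _ _ (ProductRecurrence.sumMetric dX dY).toPseudoMetricSpace _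
        K Θ hK p q)
    exact sub_le_iff_le_add'.1 this
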